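/- Let $Q\to\mathbf R$ be a smooth fibre bundle whose typical fibre $M$ is an $m$-dimensional manifold ($m\ge 0$) and whose total space $Q$ is Hausdorff and second countable. Let $(q^0=t,q^1,\dots,q^m)$ denote bundle coordinates on $Q$, where $t$ is the Cartesian coordinate of the base; let $(t,q^i,q^i_t)$ be the induced coordinates on the first order jet manifold $J^1Q$ of sections of $Q\to\mathbf R$, and $(t,q^i,\dot t,\dot q^i)$ those on $TQ$. Let $\lambda:J^1Q\hookrightarrow TQ$, $(t,q^i,q^i_t)\mapsto(t,q^i,\dot t=1,\dot q^i=q^i_t)$, be the canonical imbedding. Latin indices run over $1,\dots,m$ and Greek indices over $0,\dots,m$; repeated indices are summed. All objects are $C^\infty$. A connection on a bundle $Y\to X$ is a smooth section of its first order jet bundle $J^1Y\to Y$, i.e. a smooth family of linear right inverses $T_{p(y)}X\to T_yY$ of the tangent projections. A dynamic equation on $Q$ is a holonomic connection $\xi=\partial_t+q^i_t\partial_i+\xi^i(t,q^j,q^j_t)\partial^t_i$ on $J^1Q\to\mathbf R$; it is written $q^i_{tt}=\xi^i$. A dynamic connection is a connection $\gamma=dq^\mu\otimes(\partial_\mu+\gamma^i_\mu\partial^t_i)$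 on $J^1Q\to Q$; its dynamic equation is $q^i_{tt}=\gamma^i_0+q^j_t\gamma^i_j$. Let $\widetilde K$ denote a (not necessarily linear) connection on $TQ\to Q$ with $K^0_\mu=0$ in bundle coordinates, $\widetilde K=dq^\mu\otimes(\partial_\mu+K^i_\mu\,\partial/\partial\dot q^i)$. (1) For every dynamic equation $\xi$ on $Q$ there exist such a connection $\widetilde K$ on $TQ\to Q$ and a dynamic connection $\gamma$ such that, in all bundle coordinates, $\gamma^i_\mu=K^i_\mu\circ\lambda$, $\ \xi^i=\gamma^i_0+q^j_t\gamma^i_j$, and hence $\xi$ has the form $$q^i_{tt}=K^i_0\circ\lambda+q^j_t\,K^i_j\circ\lambda .\qquad(*)$$ (2) Conversely, for every connection $\widetilde K$ on $TQ\to Q$ with $K^0_\mu=0$ there is exactly one dynamic connection $\gamma$ with $\gamma^i_\mu=K^i_\mu\circ\lambda$ in all bundle coordinates, there is exactly one dynamic equation on $Q$ which has the form $(*)$ in all bundle coordinates, and the latter is the dynamic equation of $\gamma$. -/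

import Mathlib

open Set
open scoped Manifold ContDiff Topology

noncomputable section

namespace TimeDependentMechanics

/-- The coordinate space `ℝⁿ`. -/
abbrev Coord (n : ℕ) := EuclideanSpace ℝ (Fin n)

/-! ### Connections -/

section Connection

variable {EX HX EY HY X Y : Type*}
  [NormedAddCommGroup EX] [NormedSpace ℝ EX] [TopologicalSpace HX]
  [NormedAddCommGroup EY] [NormedSpace ℝ EY] [TopologicalSpace HY]
  [TopologicalSpace X] [ChartedSpace HX X] [TopologicalSpace Y] [ChartedSpace HY Y]

/-- A smooth (in general non-linear) connection on a bundle `p : Y → X`, that is a smooth section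
`y ↦ (T_{p y} X → T_y Y)` of the first order jet bundle `J¹Y → Y`: at every `y` a linear
right inverse of `T_y p` (the horizontal lift of tangent vectors), depending smoothly on `y`. -/
structure Connection (IX : ModelWithCorners ℝ EX HX) (IY : ModelWithCorners ℝ EY HY)
    [IsManifold IX 1 X] [IsManifold IY 1 Y] (p : Y → X) where
  lift : ∀ y : Y, TangentSpace IX (p y) →L[ℝ] TangentSpace IY y
  proj_lift : ∀ (y : Y) (u : TangentSpace IX (p y)), mfderiv IY IX p y (lift y u) = u
  smooth : ∀ y₀ : Y, ContMDiffAt IY 𝓘(ℝ, EX →L[ℝ] EY) ∞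
    (inTangentCoordinates IX IY p id (fun y => lift y) y₀) y₀

end Connection

/-! ### The configuration bundle `Q → ℝ` -/

/-- A smooth fibre bundle `t : Q → ℝ` over the time axis, with typical fibre the `m`-dimensional
manifold `M`. -/
structure ConfigurationBundle (m : ℕ) (Q M : Type*)
    [TopologicalSpace Q] [ChartedSpace (Coord (m + 1)) Q]
    [TopologicalSpace M] [ChartedSpace (Coord m) M] where
  time : Q → ℝ
  locallyTrivial : ∀ t₀ : ℝ, ∃ Φ : Bundle.Trivialization M time, t₀ ∈ Φ.baseSet ∧
    ContMDiffOn 𝓘(ℝ, Coord (m + 1)) (𝓘(ℝ, ℝ).prod 𝓘(ℝ, Coord m)) ∞ Φ Φ.source ∧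
    ContMDiffOn (𝓘(ℝ, ℝ).prod 𝓘(ℝ, Coord m)) 𝓘(ℝ, Coord (m + 1)) ∞
      Φ.toOpenPartialHomeomorph.symm Φ.target

/-- `(t, (y¹, …, yᵐ)) ↦ (t, y¹, …, yᵐ)`. -/
def consCoord {m : ℕ} (p : ℝ × Coord m) : Coord (m + 1) :=
  WithLp.toLp 2 (Fin.cons p.1 (fun i => p.2 i))

/-- `(x⁰, x¹, …, xᵐ) ↦ (x¹, …, xᵐ)`. -/
def tailCoord {m : ℕ} (x : Coord (m + 1)) : Coord m :=
  WithLp.toLp 2 (fun i => x i.succ)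

@[simp] theorem consCoord_zero {m : ℕ} (p : ℝ × Coord m) : consCoord p 0 = p.1 := rfl

@[simp] theorem consCoord_succ {m : ℕ} (p : ℝ × Coord m) (i : Fin m) :
    consCoord p i.succ = p.2 i := rfl

@[simp] theorem tailCoord_apply {m : ℕ} (x : Coord (m + 1)) (i : Fin m) :
    tailCoord x i = x i.succ := rfl

@[simp] theorem tailCoord_consCoord {m : ℕ} (p : ℝ × Coord m) :
    tailCoord (consCoord p) = p.2 := by
  ext i; rfl

@[simp] theorem consCoord_tailCoord {m : ℕ} (x : Coord (m + 1)) :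
    consCoord (x 0, tailCoord x) = x := by
  ext i
  refine Fin.cases ?_ (fun j => ?_) i <;> rfl

theorem contDiff_coord {n : ℕ} (i : Fin n) : ContDiff ℝ ∞ (fun x : Coord n => x i) :=
  (EuclideanSpace.proj (𝕜 := ℝ) i).contDiff

theorem contDiff_consCoord {m : ℕ} : ContDiff ℝ ∞ (consCoord (m := m)) := by
  rw [contDiff_euclidean]
  intro i
  refine Fin.cases ?_ (fun j => ?_) i
  · exact contDiff_fst
  · exact (contDiff_coord j).comp contDiff_snd

theorem contDiff_tailCoord {m : ℕ} : ContDiff ℝ ∞ (tailCoord (m := m)) := by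
  rw [contDiff_euclidean]
  intro i
  exact contDiff_coord i.succ

/-- `ℝ × ℝᵐ ≃ ℝᵐ⁺¹`. -/
def consHomeomorph (m : ℕ) : (ℝ × Coord m) ≃ₜ Coord (m + 1) where
  toFun := consCoord
  invFun x := (x 0, tailCoord x)
  left_inv p := by simp
  right_inv x := by simp
  continuous_toFun := contDiff_consCoord.continuous
  continuous_invFun := ((contDiff_coord 0).prodMk contDiff_tailCoord).continuous

namespace ConfigurationBundle

variable {m : ℕ} {Q M : Type*}
  [TopologicalSpace Q] [ChartedSpace (Coord (m + 1)) Q]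
  [TopologicalSpace M] [ChartedSpace (Coord m) M]
  (B : ConfigurationBundle m Q M)

/-- Bundle coordinates `(q⁰ = t, q¹, …, qᵐ)` on an open subset of `Q`: smooth local coordinates
whose coordinate of index `0` is the time. -/
structure Chart extends OpenPartialHomeomorph Q (Coord (m + 1)) where
  contMDiffOn_toFun : ContMDiffOn 𝓘(ℝ, Coord (m + 1)) 𝓘(ℝ, Coord (m + 1)) ∞
    toOpenPartialHomeomorph toOpenPartialHomeomorph.source
  contMDiffOn_symm : ContMDiffOn 𝓘(ℝ, Coord (m + 1)) 𝓘(ℝ, Coord (m + 1)) ∞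
    toOpenPartialHomeomorph.symm toOpenPartialHomeomorph.target
  coord_zero : ∀ q ∈ toOpenPartialHomeomorph.source, toOpenPartialHomeomorph q 0 = B.time q

/-! ### The jet manifold `J¹Q` -/

/-- A point of `J¹Q`: the first order jet at time `t(q)` of a section of `Q → ℝ` through `q`,
given by its velocity, a tangent vector `∂ₜ + qⁱₜ ∂ᵢ` at `q` which projects onto `∂ₜ`. -/
@[ext]
structure J1 where
  pt : Q
  vec : TangentSpace 𝓘(ℝ, Coord (m + 1)) pt
  dt_vec : mfderiv 𝓘(ℝ, Coord (m + 1)) 𝓘(ℝ, ℝ) B.time pt vec = (1 : ℝ)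

variable {B}

namespace Chart

variable (e : B.Chart)

theorem mdifferentiable : e.toOpenPartialHomeomorph.MDifferentiable
    𝓘(ℝ, Coord (m + 1)) 𝓘(ℝ, Coord (m + 1)) :=
  ⟨e.contMDiffOn_toFun.mdifferentiableOn (by simp), e.contMDiffOn_symm.mdifferentiableOn (by simp)⟩

/-- The derivative `v = vᵘ ∂ᵤ ↦ (v⁰, …, vᵐ)` of the coordinate map at `q`. -/
def D (q : Q) : TangentSpace 𝓘(ℝ, Coord (m + 1)) q →L[ℝ] Coord (m + 1) :=
  mfderiv 𝓘(ℝ, Coord (m + 1)) 𝓘(ℝ, Coord (m + 1)) e.toOpenPartialHomeomorph q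

/-- The tangent vector `aᵘ ∂ᵤ` at the point with coordinates `x`. -/
def Dsymm (x : Coord (m + 1)) :
    Coord (m + 1) →L[ℝ] TangentSpace 𝓘(ℝ, Coord (m + 1)) (e.symm x) :=
  mfderiv 𝓘(ℝ, Coord (m + 1)) 𝓘(ℝ, Coord (m + 1)) e.toOpenPartialHomeomorph.symm x

theorem D_Dsymm {x : Coord (m + 1)} (hx : x ∈ e.target) (a : Coord (m + 1)) :
    e.D (e.symm x) (e.Dsymm x a) = a :=
  DFunLike.congr_fun (e.mdifferentiable.comp_symm_deriv hx) a

theorem D_zero {q : Q} (hq : q ∈ e.source) (v : TangentSpace 𝓘(ℝ, Coord (m + 1)) q) :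
    e.D q v 0 = mfderiv 𝓘(ℝ, Coord (m + 1)) 𝓘(ℝ, ℝ) B.time q v := by
  have h1 : B.time =ᶠ[𝓝 q] (fun x : Coord (m + 1) => x 0) ∘ e.toOpenPartialHomeomorph :=
    Filter.eventually_of_mem (e.open_source.mem_nhds hq) (fun y hy => (e.coord_zero y hy).symm)
  have h2 : MDifferentiableAt 𝓘(ℝ, Coord (m + 1)) 𝓘(ℝ, ℝ) (fun x : Coord (m + 1) => x 0)
      (e.toOpenPartialHomeomorph q) :=
    (contDiff_coord 0).contMDiff.mdifferentiable (by simp) _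
  rw [h1.mfderiv_eq, mfderiv_comp q h2 (e.mdifferentiable.mdifferentiableAt hq), mfderiv_eq_fderiv,
    show (fun x : Coord (m + 1) => x 0) = EuclideanSpace.proj (𝕜 := ℝ) (0 : Fin (m + 1)) from rfl,
    ContinuousLinearMap.fderiv]
  rfl

theorem dt_Dsymm {x : Coord (m + 1)} (hx : x ∈ e.target) (y : Coord m) :
    mfderiv 𝓘(ℝ, Coord (m + 1)) 𝓘(ℝ, ℝ) B.time (e.symm x) (e.Dsymm x (consCoord (1, y)))
      = (1 : ℝ) := by
  rw [← e.D_zero (e.map_target hx), e.D_Dsymm hx]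
  rfl

variable [IsManifold 𝓘(ℝ, Coord m) ∞ M]

variable (B) in
/-- Every point of `Q` lies in the domain of some bundle coordinates. -/
theorem _root_.TimeDependentMechanics.ConfigurationBundle.exists_chart (q : Q) : ∃ e : B.Chart, q ∈ e.source := by
  obtain ⟨Φ, hb, h1, h2⟩ := B.locallyTrivial (B.time q)
  have hq : q ∈ Φ.source := Φ.mem_source.2 hb
  let c : OpenPartialHomeomorph M (Coord m) := chartAt (Coord m) (Φ q).2
  have hc1 : ContMDiffOn 𝓘(ℝ, Coord m) 𝓘(ℝ, Coord m) ∞ c c.source := contMDiffOn_chart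
  have hc2 : ContMDiffOn 𝓘(ℝ, Coord m) 𝓘(ℝ, Coord m) ∞ c.symm c.target := contMDiffOn_chart_symm
  let e : OpenPartialHomeomorph Q (Coord (m + 1)) :=
    (Φ.toOpenPartialHomeomorph.trans ((OpenPartialHomeomorph.refl ℝ).prod c)).trans
      (consHomeomorph m).toOpenPartialHomeomorph
  have hs : ∀ x ∈ e.source, x ∈ Φ.source ∧ (Φ x).2 ∈ c.source := by
    intro x hx
    simpa [e] using hx
  have ht : ∀ x ∈ e.target, tailCoord x ∈ c.target ∧ (x 0, c.symm (tailCoord x)) ∈ Φ.target := by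
    intro x hx
    simpa [e, consHomeomorph, and_comm] using hx
  refine ⟨⟨e, ?_, ?_, ?_⟩, ?_⟩
  · intro x hx
    have A := (h1.mono (fun y hy => (hs y hy).1)) x hx
    have B1 := A.fst
    have B2 := (hc1 (Φ x).2 (hs x hx).2).comp x A.snd (fun y hy => (hs y hy).2)
    exact contDiff_consCoord.contMDiff.contMDiffAt.comp_contMDiffWithinAt x
      (B1.prodMk_space B2)
  · intro x hx
    have A := (hc2 (tailCoord x) (ht x hx).1).comp x
      (contDiff_tailCoord.contMDiff.contMDiffAt.contMDiffWithinAt) (fun y hy => (ht y hy).1)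
    have A' := (contDiff_coord (n := m + 1) 0).contMDiff.contMDiffAt.contMDiffWithinAt
      (x := x) (s := e.target)
    exact ContMDiffWithinAt.comp (f := fun x => (x 0, c.symm (tailCoord x))) x
      (h2 _ (ht x hx).2) (A'.prodMk A) (fun y hy => (ht y hy).2)
  · intro x hx
    have := Φ.proj_toFun x (hs x hx).1
    exact this
  · have : (Φ q).2 ∈ c.source := mem_chart_source _ _
    simpa [e] using And.intro hq this

open Classical in
/-- The coordinates `(q⁰ = t, qⁱ, qⁱₜ)` on `J¹Q` induced by bundle coordinates on `Q`. -/
def jet : PartialEquiv B.J1 (Coord (m + 1) × Coord m) where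
  toFun v := (e.toOpenPartialHomeomorph v.pt, tailCoord (e.D v.pt v.vec))
  invFun p :=
    if h : p.1 ∈ e.target then ⟨e.symm p.1, e.Dsymm p.1 (consCoord (1, p.2)), e.dt_Dsymm h p.2⟩
    else Classical.choice (by
      obtain ⟨e', h'⟩ := B.exists_chart (e.symm p.1)
      exact ⟨⟨_, _, e'.dt_Dsymm (e'.map_source h') 0⟩⟩)
  source := {v | v.pt ∈ e.source}
  target := e.target ×ˢ univ
  map_source' v hv := ⟨e.map_source hv, mem_univ _⟩
  map_target' p hp := by
    have h : p.1 ∈ e.target := hp.1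
    simp only [h, dite_true]
    exact e.map_target h
  left_inv' v hv := by
    have hv' : v.pt ∈ e.source := hv
    have h : e.toOpenPartialHomeomorph v.pt ∈ e.target := e.map_source hv'
    have h0 : consCoord (1, tailCoord (e.D v.pt v.vec)) = e.D v.pt v.vec := by
      conv_rhs => rw [← consCoord_tailCoord (e.D v.pt v.vec)]
      rw [e.D_zero hv', v.dt_vec]
    simp only [h, dite_true, h0]
    have h1 : e.Dsymm (e.toOpenPartialHomeomorph v.pt) (e.D v.pt v.vec) = v.vec :=
      DFunLike.congr_fun (e.mdifferentiable.symm_comp_deriv hv') v.vec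
    ext1
    · exact e.left_inv hv'
    · exact h1
  right_inv' p hp := by
    have h : p.1 ∈ e.target := hp.1
    rw [dif_pos h]
    ext1
    · exact e.right_inv h
    · simp only [e.D_Dsymm h, tailCoord_consCoord]

theorem jet_symm_eq {p : Coord (m + 1) × Coord m} (h : p.1 ∈ e.target) :
    e.jet.symm p = ⟨e.symm p.1, e.Dsymm p.1 (consCoord (1, p.2)), e.dt_Dsymm h p.2⟩ :=
  dif_pos h

theorem jet_symm_pt {p : Coord (m + 1) × Coord m} (h : p.1 ∈ e.target) :
    (e.jet.symm p).pt = e.symm p.1 := by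
  rw [e.jet_symm_eq h]

theorem jet_symm_source (e' : B.Chart) :
    (e.jet.symm.trans e'.jet).source =
      (e.toOpenPartialHomeomorph.symm.trans e'.toOpenPartialHomeomorph).source ×ˢ univ := by
  ext p
  have : p ∈ (e.jet.symm.trans e'.jet).source ↔
      p.1 ∈ e.target ∧ (e.jet.symm p).pt ∈ e'.source := by
    simp [jet]
  rw [this]
  simp only [OpenPartialHomeomorph.trans_source, mem_prod, mem_univ, and_true]
  refine and_congr_right fun h => ?_
  rw [e.jet_symm_pt h]
  rfl

theorem jet_trans (e' : B.Chart) : ContDiffOn ℝ ∞ (e.jet.symm.trans e'.jet)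
    (e.jet.symm.trans e'.jet).source := by
  set φ := e.toOpenPartialHomeomorph.symm.trans e'.toOpenPartialHomeomorph with hφ
  have h1 : ContDiffOn ℝ ∞ φ φ.source := by
    rw [← contMDiffOn_iff_contDiffOn]
    exact e'.contMDiffOn_toFun.comp (e.contMDiffOn_symm.mono (fun x hx => by
      rw [hφ, OpenPartialHomeomorph.trans_source] at hx; exact hx.1)) (fun x hx => by
      rw [hφ, OpenPartialHomeomorph.trans_source] at hx; exact hx.2)
  have h2 : ContDiffOn ℝ ∞ (fun p : Coord (m + 1) × Coord m =>
      (φ p.1, tailCoord (fderiv ℝ φ p.1 (consCoord (1, p.2))))) (φ.source ×ˢ univ) := by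
    have h3 : ContDiffOn ℝ ∞ (fderiv ℝ φ) φ.source :=
      h1.fderiv_of_isOpen φ.open_source (by simp)
    have h4 : ContDiffOn ℝ ∞ (fun p : Coord (m + 1) × Coord m => fderiv ℝ φ p.1)
        (φ.source ×ˢ univ) := h3.comp contDiff_fst.contDiffOn (fun p hp => hp.1)
    exact (h1.comp contDiff_fst.contDiffOn (fun p hp => hp.1)).prodMk
      (contDiff_tailCoord.comp_contDiffOn (h4.clm_apply
        (contDiff_consCoord.comp (contDiff_const.prodMk contDiff_snd)).contDiffOn))
  rw [jet_symm_source]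
  refine h2.congr fun p hp => ?_
  have hx : p.1 ∈ e.target ∧ e.symm p.1 ∈ e'.source := by
    have := hp.1
    rw [OpenPartialHomeomorph.trans_source] at this
    exact this
  have h5 : fderiv ℝ φ p.1 (consCoord (1, p.2)) =
      e'.D (e.symm p.1) (e.Dsymm p.1 (consCoord (1, p.2))) := by
    rw [← mfderiv_eq_fderiv]
    have := mfderiv_comp p.1 (e'.mdifferentiable.mdifferentiableAt hx.2)
      (e.mdifferentiable.mdifferentiableAt_symm hx.1)
    exact DFunLike.congr_fun this _
  change (e'.toOpenPartialHomeomorph (e.jet.symm p).pt,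
    tailCoord (e'.D (e.jet.symm p).pt (e.jet.symm p).vec)) = _
  rw [e.jet_symm_eq hx.1, h5]
  rfl

end Chart

variable (B) [IsManifold 𝓘(ℝ, Coord m) ∞ M]

/-- The coordinates `(t, qⁱ, qⁱₜ)` make up an atlas of `J¹Q`. -/
def jetAtlas : ChartedSpaceCore (Coord (m + 1) × Coord m) B.J1 where
  atlas := range (fun e : B.Chart => e.jet)
  chartAt v := (B.exists_chart v.pt).choose.jet
  mem_chart_source v := (B.exists_chart v.pt).choose_spec
  chart_mem_atlas v := mem_range_self _
  open_source := by
    rintro _ _ ⟨e, rfl⟩ ⟨e', rfl⟩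
    dsimp only
    rw [Chart.jet_symm_source]
    exact (OpenPartialHomeomorph.open_source _).prod isOpen_univ
  continuousOn_toFun := by
    rintro _ _ ⟨e, rfl⟩ ⟨e', rfl⟩
    exact (e.jet_trans e').continuousOn

instance : TopologicalSpace B.J1 := B.jetAtlas.toTopologicalSpace

instance : ChartedSpace (Coord (m + 1) × Coord m) B.J1 := B.jetAtlas.toChartedSpace

instance : IsManifold 𝓘(ℝ, Coord (m + 1) × Coord m) ∞ B.J1 := by
  refine isManifold_of_contDiffOn _ _ _ ?_
  intro f f' hf hf'
  obtain ⟨_, ⟨e, rfl⟩, rfl⟩ : ∃ (g : _) (hg : g ∈ B.jetAtlas.atlas),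
      f = B.jetAtlas.openPartialHomeomorph g hg := by
    simpa [atlas, ChartedSpace.atlas, ChartedSpaceCore.toChartedSpace] using hf
  obtain ⟨_, ⟨e', rfl⟩, rfl⟩ : ∃ (g : _) (hg : g ∈ B.jetAtlas.atlas),
      f' = B.jetAtlas.openPartialHomeomorph g hg := by
    simpa [atlas, ChartedSpace.atlas, ChartedSpaceCore.toChartedSpace] using hf'
  refine (e.jet_trans e').mono ?_
  intro x hx
  simp only [mfld_simps] at hx
  rw [PartialEquiv.trans_source]
  exact hx

variable [IsManifold 𝓘(ℝ, Coord (m + 1)) ∞ Q]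

/-! ### Dynamic equations, dynamic connections, connections on `TQ → Q` -/

/-- The canonical imbedding `λ : J¹Q → TQ`. -/
def imbed (v : B.J1) : TangentBundle 𝓘(ℝ, Coord (m + 1)) Q := ⟨v.pt, v.vec⟩

/-- A dynamic equation on `Q → ℝ`: a connection `ξ` on `J¹Q → ℝ` which is holonomic, that is, takes
its values in `J²Q`: the horizontal lift `ξ = ξ(∂ₜ)`, which is a vector field on `J¹Q`, projects at
every `v ∈ J¹Q` onto the velocity `λ(v)`; so `ξ = ∂ₜ + qⁱₜ ∂ᵢ + ξⁱ ∂ᵢᵗ`. -/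
structure DynamicEquation extends
    Connection 𝓘(ℝ, ℝ) 𝓘(ℝ, Coord (m + 1) × Coord m) (fun v : B.J1 => B.time v.pt) where
  holonomic : ∀ v : B.J1, mfderiv 𝓘(ℝ, Coord (m + 1) × Coord m) 𝓘(ℝ, Coord (m + 1))
    (J1.pt : B.J1 → Q) v (lift v (1 : ℝ)) = v.vec

/-- A dynamic connection: a connection `γ` on the affine jet bundle `J¹Q → Q`. -/
abbrev DynamicConnection :=
  Connection 𝓘(ℝ, Coord (m + 1)) 𝓘(ℝ, Coord (m + 1) × Coord m) (J1.pt : B.J1 → Q)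

/-- A (non-linear) connection `K` on the tangent bundle `TQ → Q`. -/
abbrev TangentConnection (_B : ConfigurationBundle m Q M) :=
  Connection 𝓘(ℝ, Coord (m + 1)) 𝓘(ℝ, Coord (m + 1)).tangent
    (Bundle.TotalSpace.proj : TangentBundle 𝓘(ℝ, Coord (m + 1)) Q → Q)

variable {B}

/-- The coordinate vector `∂_μ` at `q` (for `q` in the domain of the coordinates). -/
def Chart.partialVec (e : B.Chart) (μ : Fin (m + 1)) (q : Q) :
    TangentSpace 𝓘(ℝ, Coord (m + 1)) q :=
  e.Dsymm (e.toOpenPartialHomeomorph q) (EuclideanSpace.single μ (1 : ℝ))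

/-- The fibre coordinate `q̇^ν` on `TQ`. -/
def Chart.dot (e : B.Chart) (ν : Fin (m + 1)) (w : TangentBundle 𝓘(ℝ, Coord (m + 1)) Q) : ℝ :=
  e.D w.proj w.snd ν

/-- The fibre coordinate `qⁱₜ` on `J¹Q`. -/
def Chart.vel (e : B.Chart) (i : Fin m) (v : B.J1) : ℝ :=
  e.D v.pt v.vec i.succ

/-- The component `ξⁱ` of a dynamic equation. -/
def DynamicEquation.comp (ξ : B.DynamicEquation) (e : B.Chart) (i : Fin m) (v : B.J1) : ℝ :=
  mfderiv 𝓘(ℝ, Coord (m + 1) × Coord m) 𝓘(ℝ, ℝ) (e.vel i) v (ξ.lift v (1 : ℝ))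

/-- The component `γⁱ_μ` of a dynamic connection. -/
def DynamicConnection.comp (γ : B.DynamicConnection) (e : B.Chart) (i : Fin m) (μ : Fin (m + 1))
    (v : B.J1) : ℝ :=
  mfderiv 𝓘(ℝ, Coord (m + 1) × Coord m) 𝓘(ℝ, ℝ) (e.vel i) v (γ.lift v (e.partialVec μ v.pt))

/-- The component `K^ν_μ` of a connection on `TQ → Q`. -/
def TangentConnection.comp (K : B.TangentConnection) (e : B.Chart) (ν μ : Fin (m + 1))
    (w : TangentBundle 𝓘(ℝ, Coord (m + 1)) Q) : ℝ :=
  mfderiv 𝓘(ℝ, Coord (m + 1)).tangent 𝓘(ℝ, ℝ) (e.dot ν) w (K.lift w (e.partialVec μ w.proj))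

/-- `K⁰_μ = 0` in all bundle coordinates: `K = dq^μ ⊗ (∂_μ + Kⁱ_μ ∂̇ᵢ)`. -/
def TangentConnection.TimeComponentsVanish (K : B.TangentConnection) : Prop :=
  ∀ (e : B.Chart) (w : TangentBundle 𝓘(ℝ, Coord (m + 1)) Q), w.proj ∈ e.source →
    ∀ μ : Fin (m + 1), K.comp e 0 μ w = 0

/-- The dynamic equation `qⁱₜₜ = γⁱ₀ + qʲₜ γⁱⱼ` of a dynamic connection is `ξ`. -/
def DynamicConnection.Yields (γ : B.DynamicConnection) (ξ : B.DynamicEquation) : Prop :=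
  ∀ (e : B.Chart) (v : B.J1), v.pt ∈ e.source → ∀ i : Fin m,
    ξ.comp e i v = γ.comp e i 0 v + ∑ j : Fin m, e.vel j v * γ.comp e i j.succ v

/-- `γⁱ_μ = Kⁱ_μ ∘ λ` in all bundle coordinates. -/
def TangentConnection.RestrictsTo (K : B.TangentConnection) (γ : B.DynamicConnection) : Prop :=
  ∀ (e : B.Chart) (v : B.J1), v.pt ∈ e.source → ∀ (i : Fin m) (μ : Fin (m + 1)),
    γ.comp e i μ v = K.comp e i.succ μ (B.imbed v)

/-- The dynamic equation `ξ` has the form `qⁱₜₜ = Kⁱ₀ ∘ λ + qʲₜ Kⁱⱼ ∘ λ` in all bundle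
coordinates. -/
def DynamicEquation.HasForm (ξ : B.DynamicEquation) (K : B.TangentConnection) : Prop :=
  ∀ (e : B.Chart) (v : B.J1), v.pt ∈ e.source → ∀ i : Fin m,
    ξ.comp e i v = K.comp e i.succ 0 (B.imbed v)
      + ∑ j : Fin m, e.vel j v * K.comp e i.succ j.succ (B.imbed v)

end ConfigurationBundle

end TimeDependentMechanics
end

/-!
The imbedding `λ` identifies `J¹Q` with the hypersurface `ṫ = 1` of `TQ`. The condition `K⁰_μ = 0`
says that the horizontal lifts along `K` annihilate `dṫ`, i.e. that at points of this hypersurface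
they are tangent to it; so `K` restricts to a unique dynamic connection `γ`, and `(∗)` says that
`λ_* ξ` at `v` is the `K`-horizontal lift of the velocity `λ(v)`. Conversely, in a bundle chart one
may take `Kⁱ₀ = ξⁱ` and `Kⁱⱼ = 0`. The conditions `K⁰_μ = 0` and `(∗)` are affine in `K`, so they
survive gluing the local choices with a partition of unity on `Q`.
-/

open Filter

noncomputable section

namespace TimeDependentMechanics

section SmoothFamilyAt

variable {E H E' H' E'' H'' F G M M' M'' N : Type*}
  [NormedAddCommGroup E] [NormedSpace ℝ E] [TopologicalSpace H] {I : ModelWithCorners ℝ E H}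
  [NormedAddCommGroup E'] [NormedSpace ℝ E'] [TopologicalSpace H'] {I' : ModelWithCorners ℝ E' H'}
  [NormedAddCommGroup E''] [NormedSpace ℝ E''] [TopologicalSpace H'']
  {I'' : ModelWithCorners ℝ E'' H''}
  [NormedAddCommGroup F] [NormedSpace ℝ F] [TopologicalSpace G] {J : ModelWithCorners ℝ F G}
  [TopologicalSpace M] [ChartedSpace H M] [TopologicalSpace M'] [ChartedSpace H' M']
  [TopologicalSpace M''] [ChartedSpace H'' M'']
  [TopologicalSpace N] [ChartedSpace G N]

/-- The linear maps `ϕ x : T_{f x} M → T_{g x} M'` depend smoothly on `x` at `x₀`: the notion of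
smoothness in the definition of a `Connection`. -/
def SmoothFamilyAt (J : ModelWithCorners ℝ F G) (I : ModelWithCorners ℝ E H)
    (I' : ModelWithCorners ℝ E' H') [IsManifold I 1 M] [IsManifold I' 1 M'] (f : N → M) (g : N → M')
    (ϕ : ∀ x, TangentSpace I (f x) →L[ℝ] TangentSpace I' (g x)) (x₀ : N) : Prop :=
  ContMDiffAt J 𝓘(ℝ, E →L[ℝ] E') ∞ (inTangentCoordinates I I' f g (fun x => ϕ x) x₀) x₀

namespace SmoothFamilyAt

variable [IsManifold I 1 M] [IsManifold I' 1 M'] [IsManifold I'' 1 M'']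
  {f : N → M} {g : N → M'} {x₀ : N}

theorem congr {g' : N → M'} {ϕ : ∀ x, TangentSpace I (f x) →L[ℝ] TangentSpace I' (g x)}
    {ϕ' : ∀ x, TangentSpace I (f x) →L[ℝ] TangentSpace I' (g' x)}
    (h : SmoothFamilyAt J I I' f g ϕ x₀) (hg : g' =ᶠ[𝓝 x₀] g)
    (hϕ : ∀ᶠ x in 𝓝 x₀, (ϕ' x : E →L[ℝ] E') = ϕ x) : SmoothFamilyAt J I I' f g' ϕ' x₀ := by
  refine ContMDiffAt.congr_of_eventuallyEq h ?_
  filter_upwards [hg, hϕ] with x hgx hϕx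
  let coordinates (c d : M') (A : E →L[ℝ] E') : E →L[ℝ] E' :=
    ContinuousLinearMap.inCoordinates E (TangentSpace I) E' (TangentSpace I') (f x₀) (f x) c d A
  change coordinates (g' x₀) (g' x) (ϕ' x) = coordinates (g x₀) (g x) (ϕ x)
  rw [hgx, hϕx, hg.eq_of_nhds]

theorem comp {h : N → M''} {ψ : ∀ x, TangentSpace I' (g x) →L[ℝ] TangentSpace I'' (h x)}
    {ϕ : ∀ x, TangentSpace I (f x) →L[ℝ] TangentSpace I' (g x)}
    (hψ : SmoothFamilyAt J I' I'' g h ψ x₀) (hϕ : SmoothFamilyAt J I I' f g ϕ x₀)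
    (hg : ContinuousAt g x₀) : SmoothFamilyAt J I I'' f h (fun x => ψ x ∘L ϕ x) x₀ := by
  refine (ContMDiffAt.clm_comp hψ hϕ).congr_of_eventuallyEq ?_
  filter_upwards [hg.eventually (chart_source_mem_nhds H' (g x₀))] with x hx
  ext u
  exact congrArg
    (fun z =>
      (trivializationAt E'' (TangentSpace I'') (h x₀)).continuousLinearMapAt ℝ (h x) (ψ x z))
    ((trivializationAt E' (TangentSpace I') (g x₀)).symmL_continuousLinearMapAt hx _).symm

theorem sum_smul {ι : Type*} {s : Finset ι} {c : ι → N → ℝ}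
    {ϕ : ι → ∀ x, TangentSpace I (f x) →L[ℝ] TangentSpace I' (g x)}
    (hc : ∀ i ∈ s, ContMDiffAt J 𝓘(ℝ, ℝ) ∞ (c i) x₀)
    (hϕ : ∀ i ∈ s, SmoothFamilyAt J I I' f g (ϕ i) x₀) :
    SmoothFamilyAt J I I' f g (fun x => ∑ i ∈ s, c i x • ϕ i x) x₀ := by
  refine (ContMDiffAt.sum fun i hi => (hc i hi).smul (hϕ i hi)).congr_of_eventuallyEq
    (Eventually.of_forall fun x => ?_)
  ext u
  let toModel : E' →L[ℝ] E' :=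
    (trivializationAt E' (TangentSpace I') (g x₀)).continuousLinearMapAt ℝ (g x)
  let ofModel : E →L[ℝ] E := (trivializationAt E (TangentSpace I) (f x₀)).symmL ℝ (f x)
  let A (i : ι) : E →L[ℝ] E' := ϕ i x
  change toModel ((∑ i ∈ s, c i x • A i) (ofModel u)) =
    (∑ i ∈ s, c i x • toModel ∘L A i ∘L ofModel) u
  simp only [sum_apply, smul_apply, map_sum, map_smul, ContinuousLinearMap.comp_apply]

theorem vectorSpace_iff {f : N → E} {g : N → E'} {ϕ : N → E →L[ℝ] E'} :
    SmoothFamilyAt J 𝓘(ℝ, E) 𝓘(ℝ, E') f g ϕ x₀ ↔ ContMDiffAt J 𝓘(ℝ, E →L[ℝ] E') ∞ ϕ x₀ := by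
  unfold SmoothFamilyAt
  rw [inTangentCoordinates_model_space]

theorem mfderiv [IsManifold J 1 N] {S : M' → M''} (hS : ContMDiffAt I' I'' ∞ S (g x₀))
    (hg : ContMDiffAt J I' ∞ g x₀) :
    SmoothFamilyAt J I' I'' g (fun x => S (g x)) (fun x => mfderiv I' I'' S (g x)) x₀ :=
  ContMDiffAt.mfderiv (fun _ => S) g
    (ContMDiffAt.comp (x₀, g x₀) (g := S) (f := Prod.snd) hS contMDiffAt_snd) hg (by simp)

end SmoothFamilyAt

end SmoothFamilyAt

section Gluing

variable {EX HX EY HY X Y ι : Type*}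
  [NormedAddCommGroup EX] [NormedSpace ℝ EX] [TopologicalSpace HX]
  [NormedAddCommGroup EY] [NormedSpace ℝ EY] [TopologicalSpace HY]
  [TopologicalSpace X] [ChartedSpace HX X] [TopologicalSpace Y] [ChartedSpace HY Y]
  {IX : ModelWithCorners ℝ EX HX} {IY : ModelWithCorners ℝ EY HY}
  {p : Y → X}

/-- The combination `∑ᵢ ρᵢ Lᵢ` of horizontal lifts `Lᵢ`, with the weights of a partition of unity on
the base; `L i y` matters only for `p y` in the support of `ρ i`. -/
def glueLift (ρ : SmoothPartitionOfUnity ι IX X)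
    (L : ι → ∀ y : Y, TangentSpace IX (p y) →L[ℝ] TangentSpace IY y) (y : Y) :
    TangentSpace IX (p y) →L[ℝ] TangentSpace IY y :=
  ∑ i ∈ ρ.finsupport (p y), ρ i (p y) • L i y

theorem map_glueLift_eq {ρ : SmoothPartitionOfUnity ι IX X}
    {L : ι → ∀ y : Y, TangentSpace IX (p y) →L[ℝ] TangentSpace IY y} {y : Y}
    {V : Type*} [AddCommGroup V] [Module ℝ V] (ℓ : TangentSpace IY y →ₗ[ℝ] V)
    {u : TangentSpace IX (p y)} {c : V}
    (h : ∀ i, p y ∈ tsupport (ρ i) → ℓ (L i y u) = c) : ℓ (glueLift ρ L y u) = c := by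
  have h_weighted : ∀ i ∈ ρ.finsupport (p y), ℓ ((ρ i (p y) • L i y) u) = ρ i (p y) • c := by
    intro i hi
    rw [smul_apply, map_smul, h i ((ρ.mem_fintsupport_iff (p y) i).1
      (ρ.finsupport_subset_fintsupport (p y) hi))]
  rw [glueLift, sum_apply, map_sum, Finset.sum_congr rfl h_weighted, ← Finset.sum_smul,
    ρ.sum_finsupport (p y) (mem_univ _), one_smul]

variable [IsManifold IX 1 X] [IsManifold IY 1 Y]

theorem smoothFamilyAt_glueLift (hp : ContMDiff IY IX ∞ p) {ρ : SmoothPartitionOfUnity ι IX X}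
    {L : ι → ∀ y : Y, TangentSpace IX (p y) →L[ℝ] TangentSpace IY y} {y₀ : Y}
    (hL : ∀ i, p y₀ ∈ tsupport (ρ i) → SmoothFamilyAt IY IX IY p id (L i) y₀) :
    SmoothFamilyAt IY IX IY p id (glueLift ρ L) y₀ := by
  have h_fixed_index : SmoothFamilyAt IY IX IY p id
      (fun y => ∑ i ∈ ρ.fintsupport (p y₀), ρ i (p y) • L i y) y₀ :=
    .sum_smul (fun i _ => (ρ i).contMDiff.contMDiffAt.comp y₀ hp.contMDiffAt)
      fun i hi => hL i ((ρ.mem_fintsupport_iff (p y₀) i).1 hi)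
  refine h_fixed_index.congr EventuallyEq.rfl ?_
  filter_upwards [hp.continuous.continuousAt.eventually
    (ρ.eventually_finsupport_subset (p y₀))] with y hy
  refine Finset.sum_subset hy fun i _ hi => ?_
  have hρ : ρ i (p y) = 0 := by simpa using hi
  exact (congrArg (fun c : ℝ => c • (L i y : EX →L[ℝ] EY)) hρ).trans (zero_smul ℝ _)

/-- The connection obtained by gluing local connections `L i` with a partition of unity. -/
def Connection.glue (hp : ContMDiff IY IX ∞ p) (ρ : SmoothPartitionOfUnity ι IX X)
    (L : ι → ∀ y : Y, TangentSpace IX (p y) →L[ℝ] TangentSpace IY y)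
    (hL : ∀ i y, p y ∈ tsupport (ρ i) → ∀ u, mfderiv IY IX p y (L i y u) = u)
    (hs : ∀ i y, p y ∈ tsupport (ρ i) → SmoothFamilyAt IY IX IY p id (L i) y) :
    Connection IX IY p where
  lift := glueLift ρ L
  proj_lift y u := map_glueLift_eq (mfderiv IY IX p y).toLinearMap fun i hi => hL i y hi u
  smooth y₀ := smoothFamilyAt_glueLift hp fun i hi => hs i y₀ hi

end Gluing

section Derivative

variable {E H M E' H' M' V W : Type*}
  [NormedAddCommGroup E] [NormedSpace ℝ E] [TopologicalSpace H] {I : ModelWithCorners ℝ E H}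
  [TopologicalSpace M] [ChartedSpace H M]
  [NormedAddCommGroup E'] [NormedSpace ℝ E'] [TopologicalSpace H'] {I' : ModelWithCorners ℝ E' H'}
  [TopologicalSpace M'] [ChartedSpace H' M']
  [NormedAddCommGroup V] [NormedSpace ℝ V] [NormedAddCommGroup W] [NormedSpace ℝ W]

theorem mvfderiv_clm_comp_apply {f : M → V} {x : M} (L : V →L[ℝ] W)
    (hf : MDifferentiableAt I 𝓘(ℝ, V) f x) (u : TangentSpace I x) :
    mvfderiv I (fun z => L (f z)) x u = L (mvfderiv I f x u) := by
  have h := mfderiv_comp_apply x L.differentiableAt.mdifferentiableAt hf u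
  rwa [mfderiv_eq_fderiv, L.fderiv] at h

theorem mfderiv_leftInverse_apply {f : M → M'} {g : M' → M} {x : M} {y : M'}
    (hg : MDifferentiableAt I' I g y) (hf : MDifferentiableAt I I' f x) (hy : f x = y)
    (hgf : g ∘ f =ᶠ[𝓝 x] id) (u : TangentSpace I x) :
    (mfderiv I' I g y (mfderiv I I' f x u) : E) = u := by
  refine (mfderiv_comp_apply_of_eq x hg hf hy u).symm.trans ?_
  rw [hgf.mfderiv_eq, mfderiv_id]
  rfl

theorem mfderiv_apply_injective {f : M → M'} {g : M' → M} {x : M}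
    (hg : MDifferentiableAt I' I g (f x)) (hf : MDifferentiableAt I I' f x)
    (hgf : g ∘ f =ᶠ[𝓝 x] id) : Function.Injective (mfderiv I I' f x) :=
  Function.LeftInverse.injective (g := mfderiv I' I g (f x))
    (mfderiv_leftInverse_apply hg hf rfl hgf)

end Derivative

section TangentBundle

variable {E H M E' H' M' : Type*}
  [NormedAddCommGroup E] [NormedSpace ℝ E] [TopologicalSpace H] {I : ModelWithCorners ℝ E H}
  [TopologicalSpace M] [ChartedSpace H M] [IsManifold I ∞ M]
  [NormedAddCommGroup E'] [NormedSpace ℝ E'] [TopologicalSpace H'] {I' : ModelWithCorners ℝ E' H'}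
  [TopologicalSpace M'] [ChartedSpace H' M'] [IsManifold I' ∞ M']

theorem contMDiff_tangentBundle_mk :
    ContMDiff 𝓘(ℝ, E × E) 𝓘(ℝ, E).tangent ∞
      (fun p : E × E => (⟨p.1, p.2⟩ : TangentBundle 𝓘(ℝ, E) E)) := by
  intro p
  rw [Bundle.contMDiffAt_totalSpace]
  refine ⟨contDiff_fst.contMDiff.contMDiffAt, ?_⟩
  simp only [trivializationAt_model_space_apply]
  exact contDiff_snd.contMDiff.contMDiffAt

theorem contMDiffAt_tangentMap {f : M → M'} {s : Set M} (hf : ContMDiffOn I I' ∞ f s)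
    (hs : IsOpen s) {w : TangentBundle I M} (hw : w.proj ∈ s) :
    ContMDiffAt I.tangent I'.tangent ∞ (tangentMap I I' f) w := by
  have h_within := hf.contMDiffOn_tangentMapWithin (m := ∞) (by simp) hs.uniqueMDiffOn
  have h_open : IsOpen (Bundle.TotalSpace.proj ⁻¹' s : Set (TangentBundle I M)) :=
    hs.preimage (FiberBundle.continuous_proj _ _)
  refine (h_within.contMDiffAt (h_open.mem_nhds hw)).congr_of_eventuallyEq ?_
  filter_upwards [h_open.mem_nhds hw] with y hy
  simp only [tangentMap, tangentMapWithin, mfderivWithin_of_isOpen hs hy]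

end TangentBundle

namespace ConfigurationBundle

variable {m : ℕ} {Q M : Type*}
  [TopologicalSpace Q] [ChartedSpace (Coord (m + 1)) Q]
  [TopologicalSpace M] [ChartedSpace (Coord m) M]
  {B : ConfigurationBundle m Q M}

local notation "𝓘Q" => 𝓘(ℝ, Coord (m + 1))
local notation "𝓘J" => 𝓘(ℝ, Coord (m + 1) × Coord m)
local notation "𝓘TQ" => ModelWithCorners.tangent 𝓘(ℝ, Coord (m + 1))

namespace Chart

variable (e : B.Chart)

theorem contMDiffAt {q : Q} (hq : q ∈ e.source) :
    ContMDiffAt 𝓘Q 𝓘Q ∞ e.toOpenPartialHomeomorph q :=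
  e.contMDiffOn_toFun.contMDiffAt (e.open_source.mem_nhds hq)

theorem contMDiffAt_symm {x : Coord (m + 1)} (hx : x ∈ e.target) :
    ContMDiffAt 𝓘Q 𝓘Q ∞ e.toOpenPartialHomeomorph.symm x :=
  e.contMDiffOn_symm.contMDiffAt (e.open_target.mem_nhds hx)

theorem Dsymm_D {q : Q} (hq : q ∈ e.source) (u : TangentSpace 𝓘Q q) :
    e.Dsymm (e.toOpenPartialHomeomorph q) (e.D q u) = u :=
  DFunLike.congr_fun (e.mdifferentiable.symm_comp_deriv hq) u

theorem D_injective {q : Q} (hq : q ∈ e.source) : Function.Injective (e.D q) :=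
  e.mdifferentiable.mfderiv_injective hq

theorem D_vec {v : B.J1} (hv : v.pt ∈ e.source) :
    e.D v.pt v.vec = consCoord (1, tailCoord (e.D v.pt v.vec)) := by
  conv_lhs => rw [← consCoord_tailCoord (e.D v.pt v.vec), e.D_zero hv, v.dt_vec]

theorem sum_partialVec {q : Q} (hq : q ∈ e.source) (u : TangentSpace 𝓘Q q) :
    ∑ μ, e.D q u μ • e.partialVec μ q = u := by
  have h := congrArg (e.Dsymm (e.toOpenPartialHomeomorph q))
    ((EuclideanSpace.basisFun (Fin (m + 1)) ℝ).sum_repr (e.D q u))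
  simp only [map_sum, map_smul, EuclideanSpace.basisFun_apply, EuclideanSpace.basisFun_repr,
    e.Dsymm_D hq] at h
  exact h

theorem vec_eq {v : B.J1} (hv : v.pt ∈ e.source) :
    v.vec = e.partialVec 0 v.pt + ∑ j : Fin m, e.vel j v • e.partialVec j.succ v.pt := by
  conv_lhs => rw [← e.sum_partialVec hv v.vec, Fin.sum_univ_succ, e.D_zero hv, v.dt_vec, one_smul]
  rfl

theorem linearMap_ext_partialVec {q : Q} (hq : q ∈ e.source) {V : Type*} [AddCommGroup V]
    [Module ℝ V] {A A' : TangentSpace 𝓘Q q →ₗ[ℝ] V}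
    (h : ∀ μ, A (e.partialVec μ q) = A' (e.partialVec μ q)) : A = A' := by
  ext u
  rw [← e.sum_partialVec hq u]
  simp only [map_sum, map_smul, h]

end Chart

section JetManifold

variable [IsManifold 𝓘(ℝ, Coord m) ∞ M]

namespace Chart

variable (e : B.Chart)

/-- The coordinates `(t, qⁱ, qⁱₜ)` as a chart of the manifold `J¹Q`. -/
def jetChart : OpenPartialHomeomorph B.J1 (Coord (m + 1) × Coord m) :=
  B.jetAtlas.openPartialHomeomorph e.jet (mem_range_self e)

theorem jetChart_mem_maximalAtlas : e.jetChart ∈ IsManifold.maximalAtlas 𝓘J ∞ B.J1 := by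
  refine IsManifold.subset_maximalAtlas ?_
  simp only [atlas, ChartedSpace.atlas, mem_iUnion, mem_singleton_iff]
  exact ⟨e.jet, mem_range_self e, rfl⟩

theorem eventually_pt_mem_source {v : B.J1} (hv : v.pt ∈ e.source) :
    ∀ᶠ v' in 𝓝 v, v'.pt ∈ e.source :=
  e.jetChart.open_source.mem_nhds hv

theorem contMDiffAt_jet {v : B.J1} (hv : v.pt ∈ e.source) : ContMDiffAt 𝓘J 𝓘J ∞ e.jet v :=
  (contMDiffOn_of_mem_maximalAtlas e.jetChart_mem_maximalAtlas).contMDiffAt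
    (e.jetChart.open_source.mem_nhds hv)

theorem contMDiffAt_jet_symm {p : Coord (m + 1) × Coord m} (hp : p.1 ∈ e.target) :
    ContMDiffAt 𝓘J 𝓘J ∞ e.jet.symm p :=
  (contMDiffOn_symm_of_mem_maximalAtlas e.jetChart_mem_maximalAtlas).contMDiffAt
    (e.jetChart.open_target.mem_nhds ⟨hp, mem_univ _⟩)

end Chart

theorem contMDiff_time : ContMDiff 𝓘Q 𝓘(ℝ, ℝ) ∞ B.time := by
  intro q
  obtain ⟨e, hq⟩ := B.exists_chart q
  refine ((contDiff_coord 0).contMDiff.contMDiffAt.comp q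
    (e.contMDiffAt hq)).congr_of_eventuallyEq ?_
  filter_upwards [e.open_source.mem_nhds hq] with q' hq'
  exact (e.coord_zero q' hq').symm

theorem contMDiff_pt : ContMDiff 𝓘J 𝓘Q ∞ (J1.pt : B.J1 → Q) := by
  intro v
  obtain ⟨e, hv⟩ := B.exists_chart v.pt
  have h_base : ContMDiffAt 𝓘J 𝓘Q ∞ (fun v' : B.J1 => (e.jet v').1) v :=
    contDiff_fst.contMDiff.contMDiffAt.comp v (e.contMDiffAt_jet hv)
  refine (ContMDiffAt.comp v (e.contMDiffAt_symm (e.map_source hv))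
    h_base).congr_of_eventuallyEq ?_
  filter_upwards [e.eventually_pt_mem_source hv] with v' hv'
  exact (e.left_inv hv').symm

end JetManifold

section TangentManifold

namespace Chart

variable (e : B.Chart)

/-- The coordinates `(q^μ, q̇^μ)` on `TQ`. -/
def tangentCoord (w : TangentBundle 𝓘Q Q) : Coord (m + 1) × Coord (m + 1) :=
  (e.toOpenPartialHomeomorph w.proj, e.D w.proj w.snd)

/-- The tangent vector with given coordinates `(q^μ, q̇^μ)`. -/
def ofTangentCoord (p : Coord (m + 1) × Coord (m + 1)) : TangentBundle 𝓘Q Q :=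
  ⟨e.symm p.1, e.Dsymm p.1 p.2⟩

theorem ofTangentCoord_tangentCoord {w : TangentBundle 𝓘Q Q} (hw : w.proj ∈ e.source) :
    e.ofTangentCoord (e.tangentCoord w) = w := by
  obtain ⟨q, u⟩ := w
  change (⟨e.symm (e.toOpenPartialHomeomorph q), e.Dsymm (e.toOpenPartialHomeomorph q) (e.D q u)⟩ :
    TangentBundle 𝓘Q Q) = ⟨q, u⟩
  rw [e.Dsymm_D hw]
  exact congrArg (fun q' => (⟨q', (u : Coord (m + 1))⟩ : TangentBundle 𝓘Q Q)) (e.left_inv hw)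

theorem tangentCoord_ofTangentCoord {p : Coord (m + 1) × Coord (m + 1)} (hp : p.1 ∈ e.target) :
    e.tangentCoord (e.ofTangentCoord p) = p :=
  Prod.ext (e.right_inv hp) (e.D_Dsymm hp p.2)

variable [IsManifold 𝓘(ℝ, Coord (m + 1)) ∞ Q]

theorem eventually_proj_mem_source {w : TangentBundle 𝓘Q Q} (hw : w.proj ∈ e.source) :
    ∀ᶠ w' in 𝓝 w, w'.proj ∈ e.source :=
  (FiberBundle.continuous_proj _ _).continuousAt.eventually (e.open_source.mem_nhds hw)

theorem contMDiffAt_tangentCoord {w : TangentBundle 𝓘Q Q} (hw : w.proj ∈ e.source) :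
    ContMDiffAt 𝓘TQ 𝓘(ℝ, Coord (m + 1) × Coord (m + 1)) ∞ e.tangentCoord w := by
  have h_base : ContMDiffAt 𝓘TQ 𝓘Q ∞
      (fun w' : TangentBundle 𝓘Q Q => e.toOpenPartialHomeomorph w'.proj) w :=
    ContMDiffAt.comp w (e.contMDiffAt hw) (Bundle.contMDiff_proj (TangentSpace 𝓘Q)).contMDiffAt
  have h_fibre := (contMDiff_snd_tangentBundle_modelSpace (Coord (m + 1)) 𝓘Q
    (n := ∞)).contMDiffAt.comp w (contMDiffAt_tangentMap e.contMDiffOn_toFun e.open_source hw)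
  exact h_base.prodMk_space h_fibre

theorem contMDiffAt_ofTangentCoord {p : Coord (m + 1) × Coord (m + 1)} (hp : p.1 ∈ e.target) :
    ContMDiffAt 𝓘(ℝ, Coord (m + 1) × Coord (m + 1)) 𝓘TQ ∞ e.ofTangentCoord p :=
  ContMDiffAt.comp p (contMDiffAt_tangentMap e.contMDiffOn_symm e.open_target
    (w := (⟨p.1, p.2⟩ : TangentBundle 𝓘Q (Coord (m + 1)))) hp) (contMDiff_tangentBundle_mk p)

theorem mdifferentiableAt_dot (ν : Fin (m + 1)) {w : TangentBundle 𝓘Q Q}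
    (hw : w.proj ∈ e.source) : MDifferentiableAt 𝓘TQ 𝓘(ℝ, ℝ) (e.dot ν) w :=
  ((contDiff_coord ν).contMDiff.contMDiffAt.comp w (contDiff_snd.contMDiff.contMDiffAt.comp w
    (e.contMDiffAt_tangentCoord hw))).mdifferentiableAt (by simp)

theorem mvfderiv_tangentCoord {w : TangentBundle 𝓘Q Q} (hw : w.proj ∈ e.source)
    (Z : TangentSpace 𝓘TQ w) :
    mvfderiv 𝓘TQ e.tangentCoord w Z =
      (e.D w.proj (mfderiv 𝓘TQ 𝓘Q Bundle.TotalSpace.proj w Z),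
        WithLp.toLp 2 fun ν => mvfderiv 𝓘TQ (e.dot ν) w Z) := by
  have hd := (e.contMDiffAt_tangentCoord hw).mdifferentiableAt (by simp)
  refine Prod.ext ?_ (PiLp.ext fun ν => ?_)
  · refine (mvfderiv_clm_comp_apply (.fst ℝ (Coord (m + 1)) (Coord (m + 1))) hd Z).symm.trans ?_
    exact mfderiv_comp_apply w (e.mdifferentiable.mdifferentiableAt hw)
      ((Bundle.contMDiff_proj (TangentSpace 𝓘Q) (n := ∞)).mdifferentiableAt (by simp)) Z
  · exact (mvfderiv_clm_comp_apply
      ((EuclideanSpace.proj ν : Coord (m + 1) →L[ℝ] ℝ) ∘L .snd ℝ _ (Coord (m + 1))) hd Z).symm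

theorem tangent_ext {w : TangentBundle 𝓘Q Q} (hw : w.proj ∈ e.source) {Z Z' : TangentSpace 𝓘TQ w}
    (h_proj : mfderiv 𝓘TQ 𝓘Q Bundle.TotalSpace.proj w Z =
      mfderiv 𝓘TQ 𝓘Q Bundle.TotalSpace.proj w Z')
    (h_dot : ∀ ν, mvfderiv 𝓘TQ (e.dot ν) w Z = mvfderiv 𝓘TQ (e.dot ν) w Z') : Z = Z' := by
  have h_leftInverse : e.ofTangentCoord ∘ e.tangentCoord =ᶠ[𝓝 w] id := by
    filter_upwards [e.eventually_proj_mem_source hw] with w' hw'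
    exact e.ofTangentCoord_tangentCoord hw'
  refine mfderiv_apply_injective
    ((e.contMDiffAt_ofTangentCoord (e.map_source hw)).mdifferentiableAt (by simp))
    ((e.contMDiffAt_tangentCoord hw).mdifferentiableAt (by simp)) h_leftInverse ?_
  change mvfderiv 𝓘TQ e.tangentCoord w Z = mvfderiv 𝓘TQ e.tangentCoord w Z'
  simp only [e.mvfderiv_tangentCoord hw, h_proj, h_dot]

theorem dot_zero_eventuallyEq (e' : B.Chart) {w : TangentBundle 𝓘Q Q}
    (hw : w.proj ∈ e.source) (hw' : w.proj ∈ e'.source) : e.dot 0 =ᶠ[𝓝 w] e'.dot 0 := by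
  filter_upwards [e.eventually_proj_mem_source hw, e'.eventually_proj_mem_source hw'] with z hz hz'
  exact (e.D_zero hz z.snd).trans (e'.D_zero hz' z.snd).symm

end Chart

end TangentManifold

section Imbedding

variable [IsManifold 𝓘(ℝ, Coord m) ∞ M]

namespace Chart

variable (e : B.Chart)

/-- The chart-wise left inverse `(t, qⁱ, ṫ, q̇ⁱ) ↦ (t, qⁱ, qⁱₜ = q̇ⁱ)` of the imbedding `λ`. -/
def toJet (w : TangentBundle 𝓘Q Q) : B.J1 :=
  e.jet.symm ((e.tangentCoord w).1, tailCoord (e.tangentCoord w).2)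

theorem toJet_imbed {v : B.J1} (hv : v.pt ∈ e.source) : e.toJet (B.imbed v) = v :=
  e.jet.left_inv hv

theorem jet_toJet {w : TangentBundle 𝓘Q Q} (hw : w.proj ∈ e.source) :
    e.jet (e.toJet w) = ((e.tangentCoord w).1, tailCoord (e.tangentCoord w).2) :=
  e.jet.right_inv ⟨e.map_source hw, mem_univ _⟩

theorem pt_toJet {w : TangentBundle 𝓘Q Q} (hw : w.proj ∈ e.source) : (e.toJet w).pt = w.proj :=
  (e.jet_symm_pt (e.map_source hw)).trans (e.left_inv hw)

end Chart

variable [IsManifold 𝓘(ℝ, Coord (m + 1)) ∞ Q]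

theorem contMDiff_imbed : ContMDiff 𝓘J 𝓘TQ ∞ B.imbed := by
  intro v
  obtain ⟨e, hv⟩ := B.exists_chart v.pt
  have h_coord : ContDiff ℝ ∞ fun p : Coord (m + 1) × Coord m => (p.1, consCoord (1, p.2)) :=
    contDiff_fst.prodMk (contDiff_consCoord.comp (contDiff_const.prodMk contDiff_snd))
  refine (ContMDiffAt.comp v
    (e.contMDiffAt_ofTangentCoord (p := ((e.jet v).1, consCoord (1, (e.jet v).2)))
      (e.map_source hv))
    (h_coord.contMDiff.contMDiffAt.comp v (e.contMDiffAt_jet hv))).congr_of_eventuallyEq ?_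
  filter_upwards [e.eventually_pt_mem_source hv] with v' hv'
  rw [← e.ofTangentCoord_tangentCoord (w := B.imbed v') hv']
  exact congrArg e.ofTangentCoord (Prod.ext rfl (e.D_vec hv'))

theorem mdifferentiableAt_imbed (v : B.J1) : MDifferentiableAt 𝓘J 𝓘TQ B.imbed v :=
  contMDiff_imbed.mdifferentiable (by simp) v

theorem mfderiv_proj_mfderiv_imbed (v : B.J1) (X : TangentSpace 𝓘J v) :
    mfderiv 𝓘TQ 𝓘Q Bundle.TotalSpace.proj (B.imbed v) (mfderiv 𝓘J 𝓘TQ B.imbed v X) =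
      mfderiv 𝓘J 𝓘Q J1.pt v X :=
  (mfderiv_comp_apply v ((Bundle.contMDiff_proj (TangentSpace 𝓘Q) (n := ∞)).mdifferentiable
    (by simp) _) (mdifferentiableAt_imbed v) X).symm

namespace Chart

variable (e : B.Chart)

theorem mvfderiv_dot_succ_mfderiv_imbed (i : Fin m) {v : B.J1} (hv : v.pt ∈ e.source)
    (X : TangentSpace 𝓘J v) :
    mvfderiv 𝓘TQ (e.dot i.succ) (B.imbed v) (mfderiv 𝓘J 𝓘TQ B.imbed v X) =
      mvfderiv 𝓘J (e.vel i) v X :=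
  (mvfderiv_comp_apply v (e.mdifferentiableAt_dot i.succ hv) (mdifferentiableAt_imbed v) X).symm

theorem mvfderiv_dot_zero_mfderiv_imbed {v : B.J1} (hv : v.pt ∈ e.source)
    (X : TangentSpace 𝓘J v) :
    mvfderiv 𝓘TQ (e.dot 0) (B.imbed v) (mfderiv 𝓘J 𝓘TQ B.imbed v X) = 0 := by
  have h_one : e.dot 0 ∘ B.imbed =ᶠ[𝓝 v] fun _ => 1 := by
    filter_upwards [e.eventually_pt_mem_source hv] with v' hv'
    exact (e.D_zero hv' v'.vec).trans v'.dt_vec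
  have hX := mvfderiv_comp_apply v (e.mdifferentiableAt_dot 0 hv) (mdifferentiableAt_imbed v) X
  rw [← hX, mvfderiv, h_one.mfderiv_eq, mfderiv_const]
  rfl

theorem contMDiffAt_toJet {w : TangentBundle 𝓘Q Q} (hw : w.proj ∈ e.source) :
    ContMDiffAt 𝓘TQ 𝓘J ∞ e.toJet w :=
  ContMDiffAt.comp w (e.contMDiffAt_jet_symm (e.map_source hw))
    ((contDiff_fst.prodMk (contDiff_tailCoord.comp contDiff_snd)).contMDiff.contMDiffAt.comp w
      (e.contMDiffAt_tangentCoord hw))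

theorem mdifferentiableAt_toJet {w : TangentBundle 𝓘Q Q} (hw : w.proj ∈ e.source) :
    MDifferentiableAt 𝓘TQ 𝓘J e.toJet w :=
  (e.contMDiffAt_toJet hw).mdifferentiableAt (by simp)

/-- The derivative of `e.toJet` at `λ(v)`, as a map to the tangent space of `J¹Q` at
`v = e.toJet (λ(v))`. -/
def toJetDeriv (v : B.J1) : TangentSpace 𝓘TQ (B.imbed v) →L[ℝ] TangentSpace 𝓘J v :=
  mfderiv 𝓘TQ 𝓘J e.toJet (B.imbed v)

theorem mfderiv_pt_toJetDeriv {v : B.J1} (hv : v.pt ∈ e.source)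
    (Z : TangentSpace 𝓘TQ (B.imbed v)) :
    mfderiv 𝓘J 𝓘Q J1.pt v (e.toJetDeriv v Z) =
      mfderiv 𝓘TQ 𝓘Q Bundle.TotalSpace.proj (B.imbed v) Z := by
  have h_pt : J1.pt ∘ e.toJet =ᶠ[𝓝 (B.imbed v)] Bundle.TotalSpace.proj := by
    filter_upwards [e.eventually_proj_mem_source (w := B.imbed v) hv] with w hw
    exact e.pt_toJet hw
  rw [← h_pt.mfderiv_eq]
  exact (mfderiv_comp_apply_of_eq _ (contMDiff_pt.mdifferentiable (by simp) _)
    (e.mdifferentiableAt_toJet hv) (e.toJet_imbed hv) Z).symm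

theorem mvfderiv_vel_toJetDeriv (i : Fin m) {v : B.J1} (hv : v.pt ∈ e.source)
    (Z : TangentSpace 𝓘TQ (B.imbed v)) :
    mvfderiv 𝓘J (e.vel i) v (e.toJetDeriv v Z) =
      mvfderiv 𝓘TQ (e.dot i.succ) (B.imbed v) Z := by
  have h_vel : e.vel i ∘ e.toJet =ᶠ[𝓝 (B.imbed v)] e.dot i.succ := by
    filter_upwards [e.eventually_proj_mem_source (w := B.imbed v) hv] with w hw
    exact congrArg (fun p => p.2 i) (e.jet_toJet hw)
  have hd : MDifferentiableAt 𝓘J 𝓘(ℝ, ℝ) (e.vel i) v :=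
    (e.mdifferentiableAt_dot i.succ hv).comp v (mdifferentiableAt_imbed v)
  rw [mvfderiv, mvfderiv, ← h_vel.mfderiv_eq]
  exact (mvfderiv_comp_apply_of_eq _ hd (e.mdifferentiableAt_toJet hv) (e.toJet_imbed hv) Z).symm

theorem mfderiv_imbed_toJetDeriv {v : B.J1} (hv : v.pt ∈ e.source)
    {Z : TangentSpace 𝓘TQ (B.imbed v)} (hZ : mvfderiv 𝓘TQ (e.dot 0) (B.imbed v) Z = 0) :
    mfderiv 𝓘J 𝓘TQ B.imbed v (e.toJetDeriv v Z) = Z := by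
  refine e.tangent_ext hv ?_ (Fin.cases ?_ fun i => ?_)
  · rw [mfderiv_proj_mfderiv_imbed, e.mfderiv_pt_toJetDeriv hv]
  · rw [hZ, e.mvfderiv_dot_zero_mfderiv_imbed hv]
  · rw [e.mvfderiv_dot_succ_mfderiv_imbed i hv, e.mvfderiv_vel_toJetDeriv i hv]

end Chart

theorem mfderiv_imbed_injective (v : B.J1) : Function.Injective (mfderiv 𝓘J 𝓘TQ B.imbed v) := by
  obtain ⟨e, hv⟩ := B.exists_chart v.pt
  refine mfderiv_apply_injective (e.mdifferentiableAt_toJet hv) (mdifferentiableAt_imbed v) ?_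
  filter_upwards [e.eventually_pt_mem_source hv] with v' hv'
  exact e.toJet_imbed hv'

end Imbedding

section Restriction

variable [IsManifold 𝓘(ℝ, Coord (m + 1)) ∞ Q]

namespace TangentConnection

variable (K : B.TangentConnection)

/-- The horizontal lifts along `K` at the point `λ(v)` of `TQ`. -/
def liftImbed (v : B.J1) : TangentSpace 𝓘Q v.pt →L[ℝ] TangentSpace 𝓘TQ (B.imbed v) :=
  K.lift (B.imbed v)

theorem mfderiv_proj_liftImbed (v : B.J1) (u : TangentSpace 𝓘Q v.pt) :
    mfderiv 𝓘TQ 𝓘Q Bundle.TotalSpace.proj (B.imbed v) (K.liftImbed v u) = u :=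
  K.proj_lift (B.imbed v) u

theorem sum_comp_imbed (e : B.Chart) {v : B.J1} (hv : v.pt ∈ e.source) (ν : Fin (m + 1)) :
    mvfderiv 𝓘TQ (e.dot ν) (B.imbed v) (K.liftImbed v v.vec) =
      K.comp e ν 0 (B.imbed v) + ∑ j : Fin m, e.vel j v * K.comp e ν j.succ (B.imbed v) := by
  conv_lhs => rw [e.vec_eq hv]
  simp only [map_add, map_sum, map_smul]
  rfl

theorem TimeComponentsVanish.mvfderiv_dot_zero_lift {K : B.TangentConnection}
    (hK : K.TimeComponentsVanish) (e : B.Chart) {w : TangentBundle 𝓘Q Q} (hw : w.proj ∈ e.source)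
    (u : TangentSpace 𝓘Q w.proj) : mvfderiv 𝓘TQ (e.dot 0) w (K.lift w u) = 0 :=
  DFunLike.congr_fun (e.linearMap_ext_partialVec hw
    (A := (mvfderiv 𝓘TQ (e.dot 0) w ∘L K.lift w).toLinearMap) (A' := 0) (hK e w hw)) u

variable [IsManifold 𝓘(ℝ, Coord m) ∞ M]

theorem restrictsTo_iff_mvfderiv {γ : B.DynamicConnection} :
    K.RestrictsTo γ ↔ ∀ (e : B.Chart) (v : B.J1), v.pt ∈ e.source → ∀ (i : Fin m) u,
      mvfderiv 𝓘J (e.vel i) v (γ.lift v u) =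
        mvfderiv 𝓘TQ (e.dot i.succ) (B.imbed v) (K.liftImbed v u) := by
  refine forall₄_congr fun e v hv i => ⟨fun h u => ?_, fun h μ => h _⟩
  exact DFunLike.congr_fun (e.linearMap_ext_partialVec hv
    (A := (mvfderiv 𝓘J (e.vel i) v ∘L γ.lift v).toLinearMap)
    (A' := (mvfderiv 𝓘TQ (e.dot i.succ) (B.imbed v) ∘L K.liftImbed v).toLinearMap) h) u

variable {K}

theorem TimeComponentsVanish.mfderiv_imbed_toJetDeriv_liftImbed (hK : K.TimeComponentsVanish)
    (e : B.Chart) {v : B.J1} (hv : v.pt ∈ e.source) (u : TangentSpace 𝓘Q v.pt) :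
    mfderiv 𝓘J 𝓘TQ B.imbed v (e.toJetDeriv v (K.liftImbed v u)) = K.liftImbed v u :=
  e.mfderiv_imbed_toJetDeriv hv (hK.mvfderiv_dot_zero_lift e (w := B.imbed v) hv u)

theorem restrictsTo_iff (hK : K.TimeComponentsVanish) {γ : B.DynamicConnection} :
    K.RestrictsTo γ ↔ ∀ v u, mfderiv 𝓘J 𝓘TQ B.imbed v (γ.lift v u) = K.liftImbed v u := by
  rw [restrictsTo_iff_mvfderiv]
  refine ⟨fun h v u => ?_, fun h e v hv i u => ?_⟩
  · obtain ⟨e, hv⟩ := B.exists_chart v.pt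
    refine e.tangent_ext hv ?_ (Fin.cases ?_ fun i => ?_)
    · rw [mfderiv_proj_mfderiv_imbed, γ.proj_lift, mfderiv_proj_liftImbed]
    · rw [e.mvfderiv_dot_zero_mfderiv_imbed hv]
      exact (hK.mvfderiv_dot_zero_lift e (w := B.imbed v) hv u).symm
    · rw [e.mvfderiv_dot_succ_mfderiv_imbed i hv, h e v hv]
  · rw [← h, e.mvfderiv_dot_succ_mfderiv_imbed i hv]

theorem hasForm_iff (hK : K.TimeComponentsVanish) {ξ : B.DynamicEquation} :
    ξ.HasForm K ↔
      ∀ v, mfderiv 𝓘J 𝓘TQ B.imbed v (ξ.lift v (1 : ℝ)) = K.liftImbed v v.vec := by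
  refine ⟨fun h v => ?_, fun h e v hv i => ?_⟩
  · obtain ⟨e, hv⟩ := B.exists_chart v.pt
    refine e.tangent_ext hv ?_ (Fin.cases ?_ fun i => ?_)
    · rw [mfderiv_proj_mfderiv_imbed, ξ.holonomic, mfderiv_proj_liftImbed]
    · rw [e.mvfderiv_dot_zero_mfderiv_imbed hv]
      exact (hK.mvfderiv_dot_zero_lift e (w := B.imbed v) hv v.vec).symm
    · rw [e.mvfderiv_dot_succ_mfderiv_imbed i hv, K.sum_comp_imbed e hv]
      exact h e v hv i
  · rw [← K.sum_comp_imbed e hv, ← h, e.mvfderiv_dot_succ_mfderiv_imbed i hv]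
    rfl

theorem smoothFamilyAt_liftImbed (v₀ : B.J1) :
    SmoothFamilyAt 𝓘J 𝓘Q 𝓘TQ J1.pt B.imbed K.liftImbed v₀ :=
  ContMDiffAt.comp v₀ (K.smooth (B.imbed v₀)) contMDiff_imbed.contMDiffAt

/-- The restriction of `K` to the submanifold `λ(J¹Q)` of `TQ`, to which its horizontal lifts are
tangent. The chart is immaterial by `TimeComponentsVanish.mfderiv_imbed_toJetDeriv_liftImbed`. -/
def toDynamicConnection (hK : K.TimeComponentsVanish) : B.DynamicConnection where
  lift v := (B.exists_chart v.pt).choose.toJetDeriv v ∘L K.liftImbed v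
  proj_lift v u := ((B.exists_chart v.pt).choose.mfderiv_pt_toJetDeriv
    (B.exists_chart v.pt).choose_spec _).trans (K.mfderiv_proj_liftImbed v u)
  smooth v₀ := by
    obtain ⟨e, hv₀⟩ := B.exists_chart v₀.pt
    have h_chart : SmoothFamilyAt 𝓘J 𝓘Q 𝓘J J1.pt (fun v => e.toJet (B.imbed v))
        (fun v => mfderiv 𝓘TQ 𝓘J e.toJet (B.imbed v) ∘L K.liftImbed v) v₀ :=
      (SmoothFamilyAt.mfderiv (e.contMDiffAt_toJet hv₀) contMDiff_imbed.contMDiffAt).comp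
        (smoothFamilyAt_liftImbed v₀) contMDiff_imbed.continuous.continuousAt
    refine h_chart.congr ?_ ?_
    · filter_upwards [e.eventually_pt_mem_source hv₀] with v hv
      exact (e.toJet_imbed hv).symm
    · filter_upwards [e.eventually_pt_mem_source hv₀] with v hv
      refine ContinuousLinearMap.ext fun u => mfderiv_imbed_injective v ?_
      exact (hK.mfderiv_imbed_toJetDeriv_liftImbed _ (B.exists_chart v.pt).choose_spec u).trans
        (hK.mfderiv_imbed_toJetDeriv_liftImbed e hv u).symm

theorem restrictsTo_toDynamicConnection (hK : K.TimeComponentsVanish) :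
    K.RestrictsTo (toDynamicConnection hK) :=
  (restrictsTo_iff hK).2 fun v =>
    hK.mfderiv_imbed_toJetDeriv_liftImbed _ (B.exists_chart v.pt).choose_spec

theorem RestrictsTo.hasForm_iff_yields {γ : B.DynamicConnection} (h : K.RestrictsTo γ)
    {ξ : B.DynamicEquation} : ξ.HasForm K ↔ γ.Yields ξ := by
  refine forall₄_congr fun e v hv i => ?_
  simp only [h e v hv]

theorem RestrictsTo.unique (hK : K.TimeComponentsVanish) {γ γ' : B.DynamicConnection}
    (h : K.RestrictsTo γ) (h' : K.RestrictsTo γ') : γ = γ' := by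
  have h_lift : γ.lift = γ'.lift := funext fun v => ContinuousLinearMap.ext fun u =>
    mfderiv_imbed_injective v
      (((restrictsTo_iff hK).1 h v u).trans ((restrictsTo_iff hK).1 h' v u).symm)
  cases γ
  cases γ'
  cases h_lift
  rfl

end TangentConnection

variable [IsManifold 𝓘(ℝ, Coord m) ∞ M]

theorem DynamicEquation.HasForm.unique {K : B.TangentConnection} (hK : K.TimeComponentsVanish)
    {ξ ξ' : B.DynamicEquation} (h : ξ.HasForm K) (h' : ξ'.HasForm K) : ξ = ξ' := by
  have h_lift : ξ.lift = ξ'.lift := funext fun v => ContinuousLinearMap.ext_ring <|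
    mfderiv_imbed_injective v (((TangentConnection.hasForm_iff hK).1 h v).trans
      ((TangentConnection.hasForm_iff hK).1 h' v).symm)
  obtain ⟨⟨_, _, _⟩, _⟩ := ξ
  obtain ⟨⟨_, _, _⟩, _⟩ := ξ'
  cases h_lift
  rfl

theorem smoothFamilyAt_toSpanSingleton_vec (v₀ : B.J1) :
    SmoothFamilyAt 𝓘J 𝓘(ℝ, ℝ) 𝓘Q (fun v : B.J1 => B.time v.pt) J1.pt
      (fun v => .toSpanSingleton ℝ v.vec) v₀ := by
  obtain ⟨e, hv₀⟩ := B.exists_chart v₀.pt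
  have h_coord : ContMDiffAt 𝓘J 𝓘(ℝ, ℝ →L[ℝ] Coord (m + 1)) ∞
      (fun v : B.J1 => ContinuousLinearMap.toSpanSingleton ℝ (consCoord (1, (e.jet v).2))) v₀ :=
    ((ContinuousLinearMap.toSpanSingletonCLE (𝕜 := ℝ) (E := Coord (m + 1))).contDiff.comp
      (contDiff_consCoord.comp (contDiff_const.prodMk contDiff_snd))).contMDiff.contMDiffAt.comp v₀
      (e.contMDiffAt_jet hv₀)
  have h_base : ContMDiffAt 𝓘J 𝓘Q ∞ (fun v : B.J1 => e.toOpenPartialHomeomorph v.pt) v₀ :=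
    (e.contMDiffAt hv₀).comp v₀ contMDiff_pt.contMDiffAt
  have h_symm := SmoothFamilyAt.mfderiv (g := fun v : B.J1 => e.toOpenPartialHomeomorph v.pt)
    (e.contMDiffAt_symm (e.map_source hv₀)) h_base
  refine (h_symm.comp (SmoothFamilyAt.vectorSpace_iff.2 h_coord) h_base.continuousAt).congr ?_ ?_
  · filter_upwards [e.eventually_pt_mem_source hv₀] with v hv
    exact (e.left_inv hv).symm
  · filter_upwards [e.eventually_pt_mem_source hv₀] with v hv
    refine ContinuousLinearMap.ext_ring ?_
    refine (one_smul ℝ _).trans (Eq.trans ?_ (congrArg (e.Dsymm _) (one_smul ℝ _).symm))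
    exact (e.Dsymm_D hv v.vec).symm.trans (congrArg (e.Dsymm _) (e.D_vec hv))

namespace DynamicConnection

variable (γ : B.DynamicConnection)

/-- The dynamic equation `qⁱₜₜ = γⁱ₀ + qʲₜ γⁱⱼ` of a dynamic connection: the vector field on `J¹Q`
whose value at `v` is the `γ`-horizontal lift of the velocity `λ(v)`. -/
def toDynamicEquation : B.DynamicEquation where
  lift v := γ.lift v ∘L .toSpanSingleton ℝ v.vec
  proj_lift v := fun (s : ℝ) => by
    refine (mfderiv_comp_apply v (contMDiff_time.mdifferentiable (by simp) v.pt)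
      (contMDiff_pt.mdifferentiable (by simp) v) _).trans ?_
    refine (congrArg _ (γ.proj_lift v (s • v.vec))).trans ((map_smul _ _ _).trans ?_)
    exact (congrArg (s * ·) v.dt_vec).trans (mul_one s)
  smooth v₀ := SmoothFamilyAt.comp (γ.smooth v₀) (smoothFamilyAt_toSpanSingleton_vec v₀)
    contMDiff_pt.continuous.continuousAt
  holonomic v := (γ.proj_lift v _).trans (one_smul ℝ v.vec)

theorem yields_toDynamicEquation : γ.Yields γ.toDynamicEquation := by
  intro e v hv i
  have h_lift : γ.toDynamicEquation.lift v (1 : ℝ) = γ.lift v v.vec :=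
    congrArg (γ.lift v) (one_smul ℝ v.vec)
  rw [DynamicEquation.comp, h_lift]
  conv_lhs => rw [e.vec_eq hv]
  simp only [map_add, map_sum, map_smul]
  rfl

end DynamicConnection

end Restriction

section LocalConnections

variable [IsManifold 𝓘(ℝ, Coord (m + 1)) ∞ Q]

namespace Chart

variable (e : B.Chart)

/-- The horizontal lift `a^μ ∂_μ ↦ a^μ (∂_μ + Γ^ν_μ ∂/∂q̇^ν)` at `w ∈ TQ`, for `Γ w = (Γ^ν_μ)`. -/
def connectionLift (Γ : TangentBundle 𝓘Q Q → Coord (m + 1) →L[ℝ] Coord (m + 1))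
    (w : TangentBundle 𝓘Q Q) : TangentSpace 𝓘Q w.proj →L[ℝ] TangentSpace 𝓘TQ w :=
  (mfderiv 𝓘(ℝ, Coord (m + 1) × Coord (m + 1)) 𝓘TQ e.ofTangentCoord (e.tangentCoord w) :
    Coord (m + 1) × Coord (m + 1) →L[ℝ] Coord (m + 1) × Coord (m + 1)) ∘L
  (ContinuousLinearMap.id ℝ (Coord (m + 1))).prod (Γ w) ∘L e.D w.proj

variable {Γ : TangentBundle 𝓘(ℝ, Coord (m + 1)) Q → Coord (m + 1) →L[ℝ] Coord (m + 1)}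

theorem mvfderiv_tangentCoord_connectionLift {w : TangentBundle 𝓘Q Q} (hw : w.proj ∈ e.source)
    (u : TangentSpace 𝓘Q w.proj) :
    mvfderiv 𝓘TQ e.tangentCoord w (e.connectionLift Γ w u) =
      (e.D w.proj u, Γ w (e.D w.proj u)) := by
  have hx : (e.tangentCoord w).1 ∈ e.target := e.map_source hw
  refine mfderiv_leftInverse_apply (I := 𝓘(ℝ, Coord (m + 1) × Coord (m + 1))) (I' := 𝓘TQ)
    ((e.contMDiffAt_tangentCoord hw).mdifferentiableAt (by simp))
    ((e.contMDiffAt_ofTangentCoord hx).mdifferentiableAt (by simp))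
    (e.ofTangentCoord_tangentCoord hw) ?_ (e.D w.proj u, Γ w (e.D w.proj u))
  filter_upwards [(e.open_target.preimage continuous_fst).mem_nhds hx] with p hp
  exact e.tangentCoord_ofTangentCoord hp

theorem mfderiv_proj_connectionLift {w : TangentBundle 𝓘Q Q} (hw : w.proj ∈ e.source)
    (u : TangentSpace 𝓘Q w.proj) :
    mfderiv 𝓘TQ 𝓘Q Bundle.TotalSpace.proj w (e.connectionLift Γ w u) = u :=
  e.D_injective hw (congrArg Prod.fst ((e.mvfderiv_tangentCoord hw _).symm.trans
    (e.mvfderiv_tangentCoord_connectionLift hw u)))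

theorem mvfderiv_dot_connectionLift {w : TangentBundle 𝓘Q Q} (hw : w.proj ∈ e.source)
    (u : TangentSpace 𝓘Q w.proj) (ν : Fin (m + 1)) :
    mvfderiv 𝓘TQ (e.dot ν) w (e.connectionLift Γ w u) = Γ w (e.D w.proj u) ν :=
  congrArg (fun p => p.2 ν) ((e.mvfderiv_tangentCoord hw _).symm.trans
    (e.mvfderiv_tangentCoord_connectionLift hw u))

theorem smoothFamilyAt_connectionLift {w₀ : TangentBundle 𝓘Q Q} (hw₀ : w₀.proj ∈ e.source)
    (hΓ : ContMDiffAt 𝓘TQ 𝓘(ℝ, Coord (m + 1) →L[ℝ] Coord (m + 1)) ∞ Γ w₀) :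
    SmoothFamilyAt 𝓘TQ 𝓘Q 𝓘TQ Bundle.TotalSpace.proj id (e.connectionLift Γ) w₀ := by
  have h_proj : ContMDiffAt 𝓘TQ 𝓘Q ∞ (Bundle.TotalSpace.proj : TangentBundle 𝓘Q Q → Q) w₀ :=
    (Bundle.contMDiff_proj (TangentSpace 𝓘Q)).contMDiffAt
  have h_prod : ContDiff ℝ ∞ fun A : Coord (m + 1) →L[ℝ] Coord (m + 1) =>
      (ContinuousLinearMap.id ℝ (Coord (m + 1))).prod A :=
    (LinearIsometryEquiv.contDiff (ContinuousLinearMap.prodₗᵢ (𝕜 := ℝ) (E := Coord (m + 1))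
      (F := Coord (m + 1)) (G := Coord (m + 1)) ℝ)).comp (contDiff_const.prodMk contDiff_id)
  have h_coord : ContMDiffAt 𝓘TQ 𝓘(ℝ, Coord (m + 1) →L[ℝ] Coord (m + 1) × Coord (m + 1)) ∞
      (fun w => (ContinuousLinearMap.id ℝ (Coord (m + 1))).prod (Γ w)) w₀ :=
    h_prod.contMDiff.contMDiffAt.comp w₀ hΓ
  refine (((SmoothFamilyAt.mfderiv (e.contMDiffAt_ofTangentCoord (p := e.tangentCoord w₀)
    (e.map_source hw₀)) (e.contMDiffAt_tangentCoord hw₀)).comp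
      (SmoothFamilyAt.vectorSpace_iff.2 h_coord)
      (e.contMDiffAt_tangentCoord hw₀).continuousAt).comp
    (SmoothFamilyAt.mfderiv (g := fun w : TangentBundle 𝓘Q Q => w.proj) (e.contMDiffAt hw₀) h_proj)
      ((e.contMDiffAt hw₀).comp w₀ h_proj).continuousAt).congr ?_ (.of_forall fun _ => rfl)
  filter_upwards [e.eventually_proj_mem_source hw₀] with w hw
  exact (e.ofTangentCoord_tangentCoord hw).symm

end Chart

namespace DynamicEquation

variable [IsManifold 𝓘(ℝ, Coord m) ∞ M] (ξ : B.DynamicEquation) (e : B.Chart)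

/-- The `q̇`-components `(0, ξ¹, …, ξᵐ)` of the image of `ξ` under the imbedding `λ`. -/
def acceleration (v : B.J1) : Coord (m + 1) :=
  (mvfderiv 𝓘TQ e.tangentCoord (B.imbed v) (mfderiv 𝓘J 𝓘TQ B.imbed v (ξ.lift v (1 : ℝ)))).2

variable {e}

theorem acceleration_apply {v : B.J1} (hv : v.pt ∈ e.source) (ν : Fin (m + 1)) :
    ξ.acceleration e v ν = mvfderiv 𝓘TQ (e.dot ν) (B.imbed v)
      (mfderiv 𝓘J 𝓘TQ B.imbed v (ξ.lift v (1 : ℝ))) :=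
  congrArg (fun p => p.2 ν) (e.mvfderiv_tangentCoord (w := B.imbed v) hv _)

theorem contMDiffAt_acceleration {v : B.J1} (hv : v.pt ∈ e.source) :
    ContMDiffAt 𝓘J 𝓘Q ∞ (ξ.acceleration e) v := by
  have h_family := (SmoothFamilyAt.mfderiv (e.contMDiffAt_tangentCoord (w := B.imbed v) hv)
    contMDiff_imbed.contMDiffAt).comp ((SmoothFamilyAt.mfderiv contMDiff_imbed.contMDiffAt
      contMDiffAt_id).comp (ξ.smooth v) continuousAt_id) contMDiff_imbed.continuous.continuousAt
  exact contDiff_snd.contMDiff.contMDiffAt.comp v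
    ((SmoothFamilyAt.vectorSpace_iff.1 h_family).clm_apply contMDiffAt_const)

variable (e)

/-- The local connection on `TQ → Q` with `Kⁱ₀(q^μ, q̇ʲ) = ξⁱ(q^μ, q̇ʲ)` and `Kⁱⱼ = 0`. -/
def localLift : ∀ w : TangentBundle 𝓘Q Q, TangentSpace 𝓘Q w.proj →L[ℝ] TangentSpace 𝓘TQ w :=
  e.connectionLift fun w =>
    (EuclideanSpace.proj (0 : Fin (m + 1))).smulRight (ξ.acceleration e (e.toJet w))

variable {e}

theorem smoothFamilyAt_localLift {w : TangentBundle 𝓘Q Q} (hw : w.proj ∈ e.source) :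
    SmoothFamilyAt 𝓘TQ 𝓘Q 𝓘TQ Bundle.TotalSpace.proj id (ξ.localLift e) w := by
  have h_jet : (e.toJet w).pt ∈ e.source := (e.pt_toJet hw).symm ▸ hw
  have h_acc := (ξ.contMDiffAt_acceleration h_jet).comp w (e.contMDiffAt_toJet hw)
  have h_smulRight : ContDiff ℝ ∞ fun a : Coord (m + 1) =>
      (EuclideanSpace.proj (0 : Fin (m + 1)) : Coord (m + 1) →L[ℝ] ℝ).smulRight a :=
    contDiff_const.smulRight contDiff_id
  exact e.smoothFamilyAt_connectionLift hw (h_smulRight.contMDiff.contMDiffAt.comp w h_acc)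

theorem mvfderiv_dot_zero_localLift {w : TangentBundle 𝓘Q Q} (hw : w.proj ∈ e.source)
    (u : TangentSpace 𝓘Q w.proj) : mvfderiv 𝓘TQ (e.dot 0) w (ξ.localLift e w u) = 0 := by
  have h_jet : (e.toJet w).pt ∈ e.source := (e.pt_toJet hw).symm ▸ hw
  have h_acc : ξ.acceleration e (e.toJet w) 0 = 0 :=
    (ξ.acceleration_apply h_jet 0).trans (e.mvfderiv_dot_zero_mfderiv_imbed h_jet _)
  refine (e.mvfderiv_dot_connectionLift hw u 0).trans ?_
  exact (congrArg (e.D w.proj u 0 * ·) h_acc).trans (mul_zero _)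

theorem localLift_imbed_vec {v : B.J1} (hv : v.pt ∈ e.source) :
    ξ.localLift e (B.imbed v) v.vec = mfderiv 𝓘J 𝓘TQ B.imbed v (ξ.lift v (1 : ℝ)) := by
  have h_time : e.D v.pt v.vec 0 = 1 := (e.D_zero hv v.vec).trans v.dt_vec
  refine e.tangent_ext hv ?_ fun ν => ?_
  · rw [mfderiv_proj_mfderiv_imbed, ξ.holonomic]
    exact e.mfderiv_proj_connectionLift (w := B.imbed v) hv v.vec
  · refine (e.mvfderiv_dot_connectionLift (w := B.imbed v) hv v.vec ν).trans ?_
    change e.D v.pt v.vec 0 * ξ.acceleration e (e.toJet (B.imbed v)) ν = _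
    rw [h_time, one_mul, e.toJet_imbed hv, ξ.acceleration_apply hv]

theorem exists_tangentConnection [T2Space Q] [SigmaCompactSpace Q] :
    ∃ K : B.TangentConnection, K.TimeComponentsVanish ∧ ξ.HasForm K := by
  choose c hc using B.exists_chart
  obtain ⟨ρ, hρ⟩ := SmoothPartitionOfUnity.exists_isSubordinate 𝓘Q isClosed_univ
    (fun q => (c q).source) (fun q => (c q).open_source) fun q _ => mem_iUnion.2 ⟨q, hc q⟩
  let K : B.TangentConnection := .glue (Bundle.contMDiff_proj (TangentSpace 𝓘Q)) ρ
    (fun i => ξ.localLift (c i)) (fun i _ hw => (c i).mfderiv_proj_connectionLift (hρ i hw))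
    fun i _ hw => ξ.smoothFamilyAt_localLift (hρ i hw)
  have hK : K.TimeComponentsVanish := fun e w hw μ =>
    map_glueLift_eq (mvfderiv 𝓘TQ (e.dot 0) w).toLinearMap fun i hi =>
      (DFunLike.congr_fun (e.dot_zero_eventuallyEq (c i) hw (hρ i hi)).mfderiv_eq _).trans
        (ξ.mvfderiv_dot_zero_localLift (hρ i hi) _)
  refine ⟨K, hK, (TangentConnection.hasForm_iff hK).2 fun v => Eq.symm ?_⟩
  exact map_glueLift_eq (p := Bundle.TotalSpace.proj) (y := B.imbed v) .id fun i hi =>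
    ξ.localLift_imbed_vec (hρ i hi)

end DynamicEquation

end LocalConnections

end ConfigurationBundle

end TimeDependentMechanics

end

open TimeDependentMechanics TimeDependentMechanics.ConfigurationBundle in
theorem proposition5p1 {m : ℕ} {Q M : Type*}
    [TopologicalSpace Q] [T2Space Q] [SecondCountableTopology Q]
    [ChartedSpace (Coord (m + 1)) Q] [IsManifold 𝓘(ℝ, Coord (m + 1)) ∞ Q]
    [TopologicalSpace M] [ChartedSpace (Coord m) M] [IsManifold 𝓘(ℝ, Coord m) ∞ M]
    (B : ConfigurationBundle m Q M) :
    (∀ ξ : B.DynamicEquation, ∃ (K : B.TangentConnection) (γ : B.DynamicConnection),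
      K.TimeComponentsVanish ∧ K.RestrictsTo γ ∧ γ.Yields ξ ∧ ξ.HasForm K) ∧
    (∀ K : B.TangentConnection, K.TimeComponentsVanish →
      (∃! γ : B.DynamicConnection, K.RestrictsTo γ) ∧
      (∃! ξ : B.DynamicEquation, ξ.HasForm K) ∧
      (∀ (γ : B.DynamicConnection) (ξ : B.DynamicEquation),
        K.RestrictsTo γ → ξ.HasForm K → γ.Yields ξ)) := by
  have : LocallyCompactSpace Q := ChartedSpace.locallyCompactSpace (Coord (m + 1)) Q
  refine ⟨fun ξ => ?_, fun K hK => ?_⟩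
  · obtain ⟨K, hK, h_form⟩ := ξ.exists_tangentConnection
    have h_restricts := TangentConnection.restrictsTo_toDynamicConnection hK
    exact ⟨K, _, hK, h_restricts, h_restricts.hasForm_iff_yields.1 h_form, h_form⟩
  · have h_restricts := TangentConnection.restrictsTo_toDynamicConnection hK
    have h_form := h_restricts.hasForm_iff_yields.2
      (DynamicConnection.yields_toDynamicEquation _)
    exact ⟨⟨_, h_restricts, fun γ hγ => hγ.unique hK h_restricts⟩,
      ⟨_, h_form, fun ξ hξ => hξ.unique hK h_form⟩,
      fun γ ξ hγ hξ => hγ.hasForm_iff_yields.1 hξ⟩
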